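/- Let $n\ge 1$, $b>0$, $\overline v>0$, and let $f$ be a probability density on $[0,b]$ (measurable, $f\ge 0$, $\int_0^b f=1$; differentiability is not needed). One item is sold to $n$ bidders whose types are drawn independently from $f$. A feasible mechanism is given by measurable allocation probabilities $q_i(t_1,\dots,t_n)\ge 0$, $i=1,\dots,n$, with $\sum_i q_i(\mathbf t)\le 1$ for all $\mathbf t\in[0,b]^n$. It implements the interim allocation rule $q$, a measurable function $q:[0,b]\to[0,\infty)$, if for every bidder $i$ one has $\mathbb E_{\mathbf t_{-i}}[q_i(t,\mathbf t_{-i})]=q(t)$ for $f$-almost every $t\in[0,b]$. Then there exists a feasible mechanism that implements $q$ if and only if for every measurable $x:[0,b]\to[0,\overline v]$ the function $qfx$ is integrable and $$\int_0^b q(t)f(t)x(t)\,dt\;\le\;\int_0^{\overline v}\frac{1-\bigl(1-\int_{\{t:\,x(t)\ge v\}}f(t)\,dt\bigr)^n}{n}\,dv .$$ Moreover, let $q$ be implementable and let $x:[0,b]\to[0,\overline v]$ be a measurable function for which equality holds in this inequality. Then for all measurable $C,D\subseteq[0,b]$ with $\int_C f>0$, $\int_D f>0$ and $x(c)>x(d)$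 for all $c\in C$, $d\in D$ (that is, $\min_C x>\max_D x$ when these are attained), $$\frac{\int_C q(t)f(t)\,dt}{\int_C f(t)\,dt}\;\ge\;\frac{\int_D q(t)f(t)\,dt}{\int_D f(t)\,dt}.$$ -/

import Mathlib

open MeasureTheory

noncomputable section

/-- The law of one bidder's type: the measure on `[0, b]` with density `f`. -/
def typeLaw (b : ℝ) (f : ℝ → ℝ) : Measure ℝ :=
  (volume.restrict (Set.Icc 0 b)).withDensity (fun t => ENNReal.ofReal (f t))

/-- A feasible (ex post) allocation rule of a direct mechanism that sells one item to `n` bidders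
with types in `[0, b]`: `alloc i t` is the probability that bidder `i` receives the item when the
reported type profile is `t`. -/
structure FeasibleAllocation (n : ℕ) (b : ℝ) where
  alloc : Fin n → (Fin n → ℝ) → ℝ
  measurable_alloc : ∀ i, Measurable (alloc i)
  alloc_nonneg : ∀ t : Fin n → ℝ, (∀ k, t k ∈ Set.Icc 0 b) → ∀ i, 0 ≤ alloc i t
  sum_alloc_le_one : ∀ t : Fin n → ℝ, (∀ k, t k ∈ Set.Icc 0 b) → ∑ i, alloc i t ≤ 1

/-- The interim allocation of bidder `i` at type `t`: the expectation of `alloc i (t, s₋ᵢ)` when the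
types of the other bidders are i.i.d. with density `f`. All `n` coordinates of `s` are drawn, and
the `i`-th one is then overwritten by `t`. -/
def FeasibleAllocation.interim {n : ℕ} {b : ℝ} (M : FeasibleAllocation n b) (f : ℝ → ℝ)
    (i : Fin n) (t : ℝ) : ℝ :=
  ∫ s, M.alloc i (Function.update s i t) ∂(Measure.pi (fun _ : Fin n => typeLaw b f))

/-- `q` is implementable: some feasible allocation rule gives every bidder the interim allocation
`q`, at almost every type with respect to the type distribution. -/
def Implementable (n : ℕ) (b : ℝ) (f q : ℝ → ℝ) : Prop :=
  ∃ M : FeasibleAllocation n b, ∀ i : Fin n, ∀ᵐ t ∂(typeLaw b f), M.interim f i t = q t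

/-- A (measurable) virtual value function on `[0, b]` with values in `[0, vbar]`. -/
def IsVirtualValue (b vbar : ℝ) (x : ℝ → ℝ) : Prop :=
  Measurable x ∧ ∀ t ∈ Set.Icc 0 b, x t ∈ Set.Icc 0 vbar

/-- The bound `∫₀^vbar (1 - (1 - ∫_{x(t) ≥ v} f(t) dt)ⁿ) / n dv`. -/
def borderBound (n : ℕ) (b vbar : ℝ) (f x : ℝ → ℝ) : ℝ :=
  ∫ v in (0 : ℝ)..vbar, (1 - (1 - ∫ t in {t ∈ Set.Icc 0 b | v ≤ x t}, f t) ^ n) / n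

end

/-!
The feasible allocation rules form a weakly compact convex subset of `L²`, so by separation `q` is
a family of interim allocations as soon as no linear functional exceeds on `q` its maximum over
this set. For weights `xᵢ` that maximum is attained by giving the item to a bidder whose weight
`xᵢ(tᵢ)` is positive and highest, which makes it `E[maxᵢ xᵢ(tᵢ)⁺]`. When all bidders share the
same type law and the same `q`, the layer-cake formula and the AM-GM inequality
`n ∏ᵢ zᵢ ≤ ∑ᵢ zᵢⁿ` show that it is enough to test equal weights, and this is Border's condition.
If equality holds at `x`, then a rule implementing `q` is such a maximizer: almost surely only
bidders with the highest weight win, and so interim allocations increase with `x`.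
-/

open Filter Topology
open scoped RealInnerProductSpace

section WeakCompactness

theorem exists_forall_bilin_eq_of_forall_exists_le {E V : Type*} [TopologicalSpace E]
    [AddCommGroup E] [Module ℝ E] [AddCommGroup V] [Module ℝ V] {A : Set E}
    (hA : IsCompact A) (hconv : Convex ℝ A) (B : V →ₗ[ℝ] E →ₗ[ℝ] ℝ) (hB : ∀ v, Continuous (B v))
    (ℓ : V →ₗ[ℝ] ℝ) (h : ∀ v, ∃ a ∈ A, ℓ v ≤ B v a) : ∃ a ∈ A, ∀ v, B v a = ℓ v := by
  classical
  have hfinite (F : Finset V) : (A ∩ ⋂ v ∈ F, {a | B v a = ℓ v}).Nonempty := by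
    let T : E →ₗ[ℝ] (F → ℝ) := LinearMap.pi fun v => B v
    have hTcont : Continuous T := continuous_pi fun v => hB v
    have hmem : (fun v : F => ℓ v) ∈ T '' A := by
      by_contra hnot
      obtain ⟨φ, u, hφA, hφℓ⟩ := geometric_hahn_banach_closed_point (hconv.linear_image T)
        (hA.image hTcont).isClosed hnot
      let c (v : F) : ℝ := φ fun w => if v = w then 1 else 0
      have hφ (z : F → ℝ) : φ z = ∑ v, c v * z v :=
        (LinearMap.pi_apply_eq_sum_univ φ.toLinearMap z).trans
          (Finset.sum_congr rfl fun _ _ => mul_comm _ _)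
      obtain ⟨a, ha, hle⟩ := h (∑ v, c v • (v : V))
      have hlt := (hφA _ ⟨a, ha, rfl⟩).trans hφℓ
      rw [hφ, hφ] at hlt
      simp only [map_sum, map_smul, LinearMap.sum_apply, LinearMap.smul_apply, smul_eq_mul] at hle
      exact hlt.not_ge hle
    obtain ⟨a, ha, haF⟩ := hmem
    exact ⟨a, ha, Set.mem_iInter₂.2 fun v hv => congrFun haF ⟨v, hv⟩⟩
  obtain ⟨a, ha, haV⟩ := hA.inter_iInter_nonempty (fun v => {a | B v a = ℓ v})
    (fun v => isClosed_eq (hB v) continuous_const) hfinite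
  exact ⟨a, ha, Set.mem_iInter.1 haV⟩

variable {H : Type*} [NormedAddCommGroup H] [InnerProductSpace ℝ H] [CompleteSpace H]

theorem isCompact_toWeakSpace_closedBall (r : ℝ) :
    IsCompact (toWeakSpace ℝ H '' Metric.closedBall 0 r) := by
  let riesz : WeakDual ℝ H → WeakSpace ℝ H := fun ψ =>
    toWeakSpace ℝ H ((InnerProductSpace.toDual ℝ H).symm (WeakDual.toStrongDual ψ))
  have hriesz : Continuous riesz := WeakBilin.continuous_of_continuous_eval _ fun φ => by
    let y := (InnerProductSpace.toDual ℝ H).symm φ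
    have hφ (ψ : WeakDual ℝ H) :
        φ ((InnerProductSpace.toDual ℝ H).symm (WeakDual.toStrongDual ψ)) = ψ y := by
      rw [← InnerProductSpace.toDual_symm_apply, real_inner_comm,
        InnerProductSpace.toDual_symm_apply]
      rfl
    exact (WeakDual.eval_continuous y).congr fun ψ => (hφ ψ).symm
  convert (WeakDual.isCompact_closedBall (𝕜 := ℝ) (E := H) 0 r).image hriesz using 1
  rw [← map_zero (InnerProductSpace.toDual ℝ H).symm, ← LinearIsometryEquiv.image_closedBall,
    Set.image_image]
  rfl

theorem isCompact_toWeakSpace_of_isClosed {A : Set H} (hconv : Convex ℝ A) (hclosed : IsClosed A)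
    (hbdd : Bornology.IsBounded A) : IsCompact (toWeakSpace ℝ H '' A) := by
  obtain ⟨r, hr⟩ := hbdd.subset_closedBall 0
  refine (isCompact_toWeakSpace_closedBall r).of_isClosed_subset ?_ (Set.image_mono hr)
  rw [← closure_eq_iff_isClosed, ← hconv.toWeakSpace_closure ℝ, hclosed.closure_eq]

theorem exists_forall_inner_eq_of_forall_exists_le {V : Type*} [AddCommGroup V] [Module ℝ V]
    {A : Set H} (hconv : Convex ℝ A) (hclosed : IsClosed A) (hbdd : Bornology.IsBounded A)
    (J : V →ₗ[ℝ] H) (ℓ : V →ₗ[ℝ] ℝ) (h : ∀ v, ∃ a ∈ A, ℓ v ≤ ⟪J v, a⟫) :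
    ∃ a ∈ A, ∀ v, ⟪J v, a⟫ = ℓ v := by
  let B : V →ₗ[ℝ] WeakSpace ℝ H →ₗ[ℝ] ℝ :=
    (innerₗ H ∘ₗ J).compl₂ (toWeakSpace ℝ H).symm.toLinearMap
  obtain ⟨_, ⟨a, ha, rfl⟩, haV⟩ := exists_forall_bilin_eq_of_forall_exists_le
    (isCompact_toWeakSpace_of_isClosed hconv hclosed hbdd)
    (hconv.linear_image (toWeakSpace ℝ H).toLinearMap) B
    (fun v => WeakBilin.eval_continuous _ (innerSL ℝ (J v))) ℓ fun v => by
      obtain ⟨a, ha, hle⟩ := h v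
      exact ⟨_, ⟨a, ha, rfl⟩, hle⟩
  exact ⟨a, ha, haV⟩

end WeakCompactness

section LpSet

variable {α E : Type*} [MeasurableSpace α] [NormedAddCommGroup E] {ν : Measure α} {p : ENNReal}
  {K : Set E}

theorem convex_setOf_ae_mem [NormedSpace ℝ E] (hK : Convex ℝ K) :
    Convex ℝ {g : Lp E p ν | ∀ᵐ s ∂ν, g s ∈ K} := by
  intro g₁ h₁ g₂ h₂ c₁ c₂ hc₁ hc₂ hc
  filter_upwards [h₁, h₂, Lp.coeFn_add (c₁ • g₁) (c₂ • g₂), Lp.coeFn_smul c₁ g₁,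
    Lp.coeFn_smul c₂ g₂] with s hs₁ hs₂ hadd hsmul₁ hsmul₂
  rw [hadd, Pi.add_apply, hsmul₁, hsmul₂]
  exact hK hs₁ hs₂ hc₁ hc₂ hc

theorem isClosed_setOf_ae_mem [Fact (1 ≤ p)] (hK : IsClosed K) :
    IsClosed {g : Lp E p ν | ∀ᵐ s ∂ν, g s ∈ K} := by
  refine IsSeqClosed.isClosed fun g g₀ hg hlim => ?_
  obtain ⟨k, -, hk⟩ := (tendstoInMeasure_of_tendsto_Lp hlim).exists_seq_tendsto_ae
  filter_upwards [hk, ae_all_iff.2 hg] with s hs hmem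
  exact hK.mem_of_tendsto hs (.of_forall fun j => hmem (k j))

theorem isBounded_setOf_ae_mem [IsFiniteMeasure ν] [Fact (1 ≤ p)] (hK : Bornology.IsBounded K) :
    Bornology.IsBounded {g : Lp E p ν | ∀ᵐ s ∂ν, g s ∈ K} := by
  obtain ⟨C, hC0, hC⟩ := hK.exists_pos_norm_le
  refine isBounded_iff_forall_norm_le.2 ⟨_, fun g hg => Lp.norm_le_of_ae_bound hC0.le ?_⟩
  filter_upwards [hg] with s hs using hC (g s) hs

end LpSet

section ProductMeasure

variable {ι : Type*} [Fintype ι] [DecidableEq ι] {X : ι → Type*} [∀ i, MeasurableSpace (X i)]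
  (μ : ∀ i, Measure (X i)) [∀ i, IsProbabilityMeasure (μ i)]

theorem measurePreserving_update (i : ι) :
    MeasurePreserving (fun p : X i × (∀ j, X j) => Function.update p.2 i p.1)
      ((μ i).prod (Measure.pi μ)) (Measure.pi μ) := by
  have hmeas : Measurable fun p : X i × (∀ j, X j) => Function.update p.2 i p.1 :=
    measurable_update'.comp measurable_swap
  refine ⟨hmeas, (Measure.pi_eq fun s hs => ?_).symm⟩
  have hpre : (fun p : X i × (∀ j, X j) => Function.update p.2 i p.1) ⁻¹' Set.univ.pi s
      = s i ×ˢ Set.univ.pi (Function.update s i Set.univ) := by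
    ext ⟨t, w⟩
    simp only [Set.mem_preimage, Set.mem_prod, Set.mem_pi]
    grind
  rw [Measure.map_apply hmeas (MeasurableSet.univ_pi hs), hpre, Measure.prod_prod, Measure.pi_pi]
  simp_rw [Function.apply_update fun j => μ j]
  rw [Finset.prod_update_of_mem (Finset.mem_univ i), measure_univ, one_mul,
    Finset.sdiff_singleton_eq_erase, Finset.mul_prod_erase _ (fun j => μ j (s j))
    (Finset.mem_univ i)]

variable {μ}

theorem ae_ae_update {p : (∀ i, X i) → Prop} (hp : ∀ᵐ s ∂Measure.pi μ, p s) (i : ι) :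
    ∀ᵐ t ∂μ i, ∀ᵐ s ∂Measure.pi μ, p (Function.update s i t) :=
  Measure.ae_ae_of_ae_prod ((measurePreserving_update μ i).quasiMeasurePreserving.ae hp)

theorem integral_pi_mul_eval (i : ι) {a : (∀ i, X i) → ℝ} {y : X i → ℝ}
    (h : Integrable (fun s => a s * y (s i)) (Measure.pi μ)) :
    ∫ s, a s * y (s i) ∂Measure.pi μ =
      ∫ t, (∫ s, a (Function.update s i t) ∂Measure.pi μ) * y t ∂μ i := by
  have hmp := measurePreserving_update μ i
  have hprod := (hmp.integrable_comp h.aestronglyMeasurable).2 h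
  have hmap := integral_map hmp.aemeasurable (f := fun s => a s * y (s i))
    (by rw [hmp.map_eq]; exact h.aestronglyMeasurable)
  rw [hmp.map_eq] at hmap
  simp only [Function.comp_def, Function.update_self] at hprod hmap
  rw [hmap, integral_prod _ hprod]
  simp only [integral_mul_const]

end ProductMeasure

section Maximum

theorem card_mul_prod_le_sum_pow_card {ι : Type*} [Fintype ι] [Nonempty ι] {z : ι → ℝ}
    (hz : ∀ i, 0 ≤ z i) : Fintype.card ι * ∏ i, z i ≤ ∑ i, z i ^ Fintype.card ι := by
  have hcard : (0 : ℝ) < Fintype.card ι := mod_cast Fintype.card_pos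
  have amgm := Real.geom_mean_le_arith_mean_weighted Finset.univ
    (fun _ : ι => (Fintype.card ι : ℝ)⁻¹) (fun i => z i ^ Fintype.card ι)
    (fun _ _ => by positivity) (by simp) (fun i _ => pow_nonneg (hz i) _)
  simpa only [Real.pow_rpow_inv_natCast (hz _) Fintype.card_ne_zero, ← Finset.mul_sum,
    le_inv_mul_iff₀ hcard] using amgm

theorem ciSup_mem_of_forall_mem {ι : Type*} [Finite ι] [Nonempty ι] {u : ι → ℝ} {S : Set ℝ}
    (h : ∀ i, u i ∈ S) : ⨆ i, u i ∈ S := by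
  obtain ⟨i, hi⟩ := exists_eq_ciSup_of_finite (f := u)
  exact hi ▸ h i

theorem le_ciSup_iff_exists_of_finite {ι : Type*} [Finite ι] [Nonempty ι] {u : ι → ℝ} {v : ℝ} :
    v ≤ ⨆ i, u i ↔ ∃ i, v ≤ u i := by
  refine ⟨fun h => ?_, fun ⟨i, hi⟩ => hi.trans (le_ciSup (Set.finite_range u).bddAbove i)⟩
  obtain ⟨i, hi⟩ := exists_eq_ciSup_of_finite (f := u)
  exact ⟨i, hi ▸ h⟩

section

variable {ι : Type*} [Fintype ι] {X : ι → Type*} [∀ i, MeasurableSpace (X i)]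
  {μ : ∀ i, Measure (X i)} [∀ i, IsProbabilityMeasure (μ i)] {x : ∀ i, X i → ℝ} {M : ℝ}

theorem ae_pi_eval_mem_Icc (hxM : ∀ i, ∀ᵐ t ∂μ i, x i t ∈ Set.Icc 0 M) :
    ∀ᵐ s ∂Measure.pi μ, ∀ i, x i (s i) ∈ Set.Icc 0 M :=
  ae_all_iff.2 fun i => Measure.tendsto_eval_ae_ae.eventually (hxM i)

theorem measureReal_pi_exists_le (hx : ∀ i, Measurable (x i)) (v : ℝ) :
    (Measure.pi μ).real {s | ∃ i, v ≤ x i (s i)} = 1 - ∏ i, (1 - (μ i).real {t | v ≤ x i t}) := by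
  have hlevel (i : ι) : MeasurableSet {t | v ≤ x i t} := measurableSet_le measurable_const (hx i)
  have hset : {s : ∀ i, X i | ∃ i, v ≤ x i (s i)} = (Set.univ.pi fun i => {t | v ≤ x i t}ᶜ)ᶜ := by
    ext s
    simp
  rw [hset, probReal_compl_eq_one_sub (MeasurableSet.univ_pi fun i => (hlevel i).compl),
    measureReal_def, Measure.pi_pi, ENNReal.toReal_prod]
  congr! with i
  exact probReal_compl_eq_one_sub (hlevel i)

theorem antitone_one_sub_prod_tail :
    Antitone fun v : ℝ => 1 - ∏ i, (1 - (μ i).real {t | v ≤ x i t}) := by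
  intro v w hvw
  have hle (i : ι) : (μ i).real {t | v ≤ x i t} ≤ 1 := measureReal_le_one
  dsimp only
  gcongr with i
  · exact fun i _ => sub_nonneg.2 (hle i)
  · exact measure_ne_top _ _

variable [Nonempty ι]

theorem integrable_iSup_eval (hx : ∀ i, Measurable (x i))
    (hxM : ∀ i, ∀ᵐ t ∂μ i, x i t ∈ Set.Icc 0 M) :
    Integrable (fun s => ⨆ i, x i (s i)) (Measure.pi μ) := by
  refine Integrable.of_bound (C := M) (Measurable.iSup fun i =>
    (hx i).comp (measurable_pi_apply i)).aestronglyMeasurable ?_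
  filter_upwards [ae_pi_eval_mem_Icc hxM] with s hs
  obtain ⟨h0, hM⟩ := ciSup_mem_of_forall_mem hs
  rwa [Real.norm_of_nonneg h0]

theorem integral_iSup_eval (hx : ∀ i, Measurable (x i))
    (hxM : ∀ i, ∀ᵐ t ∂μ i, x i t ∈ Set.Icc 0 M) :
    ∫ s, ⨆ i, x i (s i) ∂Measure.pi μ =
      ∫ v in (0 : ℝ)..M, (1 - ∏ i, (1 - (μ i).real {t | v ≤ x i t})) := by
  have hsup : ∀ᵐ s ∂Measure.pi μ, ⨆ i, x i (s i) ∈ Set.Icc 0 M :=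
    (ae_pi_eval_mem_Icc hxM).mono fun s hs => ciSup_mem_of_forall_mem hs
  obtain ⟨s, hs⟩ := hsup.exists
  rw [(integrable_iSup_eval hx hxM).integral_eq_integral_Ioc_meas_le
    (hsup.mono fun _ h => h.1) (hsup.mono fun _ h => h.2),
    intervalIntegral.integral_of_le (hs.1.trans hs.2)]
  simp only [le_ciSup_iff_exists_of_finite, measureReal_pi_exists_le hx]

end

theorem sum_integral_iSup_eval_le {ι X : Type*} [Fintype ι] [Nonempty ι] [MeasurableSpace X]
    {μ : Measure X} [IsProbabilityMeasure μ] {x : ι → X → ℝ} {M : ℝ}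
    (hx : ∀ i, Measurable (x i)) (hxM : ∀ i, ∀ᵐ t ∂μ, x i t ∈ Set.Icc 0 M) :
    ∑ i, ∫ s : ι → X, ⨆ j, x i (s j) ∂Measure.pi (fun _ => μ) ≤
      Fintype.card ι * ∫ s : ι → X, ⨆ i, x i (s i) ∂Measure.pi (fun _ => μ) := by
  have hM : 0 ≤ M := by
    obtain ⟨t, ht⟩ := (hxM (Classical.arbitrary ι)).exists
    exact ht.1.trans ht.2
  simp only [integral_iSup_eval (fun _ : ι => hx _) fun _ => hxM _]
  have htail (z : ι → X → ℝ) :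
      IntervalIntegrable (fun v => 1 - ∏ i, (1 - μ.real {t | v ≤ z i t})) volume 0 M :=
    antitone_one_sub_prod_tail.intervalIntegrable
  rw [← intervalIntegral.integral_const_mul,
    ← intervalIntegral.integral_finsetSum fun i _ => htail fun _ => x i]
  refine intervalIntegral.integral_mono_on hM (by
    simpa only [Finset.sum_fn] using
      IntervalIntegrable.sum Finset.univ fun i _ => htail fun _ => x i)
    ((htail x).const_mul _) fun v _ => ?_
  have amgm := card_mul_prod_le_sum_pow_card (z := fun i => 1 - μ.real {t | v ≤ x i t})
    fun i => sub_nonneg.2 measureReal_le_one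
  simp only [Finset.prod_const, Finset.card_univ, Finset.sum_sub_distrib, Finset.sum_const,
    nsmul_eq_mul, mul_one, mul_sub]
  linarith

end Maximum

section Subsimplex

variable {ι : Type*} [Fintype ι]

/-- The vectors of winning probabilities when at most one of the bidders `i : ι` gets the item. -/
def subsimplex (ι : Type*) [Fintype ι] : Set (ι → ℝ) := {p | (∀ i, 0 ≤ p i) ∧ ∑ i, p i ≤ 1}

theorem convex_subsimplex : Convex ℝ (subsimplex ι) := by
  have hsum : IsLinearMap ℝ fun p : ι → ℝ => ∑ i, p i :=
    ⟨fun p p' => Finset.sum_add_distrib, fun c p => by simp [Finset.mul_sum]⟩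
  exact (convex_Ici 0).inter (convex_halfSpace_le hsum 1)

theorem isClosed_subsimplex : IsClosed (subsimplex ι) :=
  isClosed_Ici.inter (isClosed_le
    (continuous_finsetSum _ fun i _ => continuous_apply i) continuous_const)

theorem measurableSet_subsimplex : MeasurableSet (subsimplex ι) :=
  isClosed_subsimplex.measurableSet

theorem mem_Icc_of_mem_subsimplex {p : ι → ℝ} (hp : p ∈ subsimplex ι) (i : ι) :
    p i ∈ Set.Icc 0 1 :=
  ⟨hp.1 i, (Finset.single_le_sum (fun j _ => hp.1 j) (Finset.mem_univ i)).trans hp.2⟩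

theorem isBounded_subsimplex : Bornology.IsBounded (subsimplex ι) :=
  (Metric.isBounded_Icc 0 1).subset fun _ hp =>
    ⟨hp.1, fun i => (mem_Icc_of_mem_subsimplex hp i).2⟩

theorem sum_mul_le_iSup {p u : ι → ℝ} (hp : p ∈ subsimplex ι) (hu : ∀ i, 0 ≤ u i) :
    ∑ i, p i * u i ≤ ⨆ i, u i :=
  calc ∑ i, p i * u i
    _ ≤ ∑ i, p i * ⨆ j, u j := by
        gcongr with i
        · exact hp.1 i
        · exact le_ciSup (Set.finite_range u).bddAbove i
    _ = (∑ i, p i) * ⨆ j, u j := (Finset.sum_mul ..).symm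
    _ ≤ ⨆ j, u j := mul_le_of_le_one_left (Real.iSup_nonneg hu) hp.2

theorem eq_zero_of_sum_mul_eq_iSup {p u : ι → ℝ} (hp : p ∈ subsimplex ι) (hu : ∀ i, 0 ≤ u i)
    (heq : ∑ i, p i * u i = ⨆ i, u i) {i : ι} (hi : u i < ⨆ j, u j) : p i = 0 := by
  have hgap (j : ι) : 0 ≤ p j * ((⨆ k, u k) - u j) :=
    mul_nonneg (hp.1 j) (sub_nonneg.2 (le_ciSup (Set.finite_range u).bddAbove j))
  have htotal : ∑ j, p j * ((⨆ k, u k) - u j) ≤ 0 := by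
    simp only [mul_sub, Finset.sum_sub_distrib, ← Finset.sum_mul, heq]
    exact sub_nonpos.2 (mul_le_of_le_one_left (Real.iSup_nonneg hu) hp.2)
  have hzero := (Finset.single_le_sum (fun j _ => hgap j) (Finset.mem_univ i)).trans htotal
  exact (mul_eq_zero.1 (hzero.antisymm (hgap i))).resolve_right (sub_pos.2 hi).ne'

/-- If `i` wins at all under `u`, then its value is highest there, so the higher value `w i` makes
it the unique winner under `w`. -/
theorem apply_le_apply_of_sum_mul_eq_iSup {p r u w : ι → ℝ} (hp : p ∈ subsimplex ι)
    (hr : r ∈ subsimplex ι) (hu : ∀ j, 0 ≤ u j) (hpu : ∑ j, p j * u j = ⨆ j, u j)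
    (hrw : ∑ j, r j * w j = ⨆ j, w j) {i : ι} (huw : ∀ j ≠ i, w j = u j) (hi : u i < w i) :
    p i ≤ r i := by
  rcases eq_or_ne (p i) 0 with hpi | hpi
  · exact hpi ▸ hr.1 i
  have hu_le (j : ι) : u j ≤ u i := (le_ciSup (Set.finite_range u).bddAbove j).trans <|
    not_lt.1 fun h => hpi (eq_zero_of_sum_mul_eq_iSup hp hu hpu h)
  have hw_lt (j : ι) (hj : j ≠ i) : w j < w i := huw j hj ▸ (hu_le j).trans_lt hi
  have hw (j : ι) : 0 ≤ w j := by
    rcases eq_or_ne j i with rfl | hj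
    exacts [(hu j).trans hi.le, huw j hj ▸ hu j]
  have hsup : ⨆ j, w j = w i := by
    have : Nonempty ι := ⟨i⟩
    refine le_antisymm (ciSup_le fun j => ?_) (le_ciSup (Set.finite_range w).bddAbove i)
    rcases eq_or_ne j i with rfl | hj
    exacts [le_rfl, (hw_lt j hj).le]
  have hr_zero (j : ι) (hj : j ≠ i) : r j = 0 :=
    eq_zero_of_sum_mul_eq_iSup hr hw hrw (hsup ▸ hw_lt j hj)
  rw [Fintype.sum_eq_single i fun j hj => by rw [hr_zero j hj, zero_mul], hsup,
    mul_eq_right₀ ((hu i).trans_lt hi).ne'] at hrw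
  exact hrw ▸ (mem_Icc_of_mem_subsimplex hp i).2

end Subsimplex

section EqualSplit

variable {ι : Type*} [Fintype ι]

open Classical in
/-- The indicator of the bidders whose value is positive and highest. -/
noncomputable def winWeight (u : ι → ℝ) (i : ι) : ℝ := if 0 < u i ∧ ∀ j, u j ≤ u i then 1 else 0

/-- The allocation that maximizes the total value of the winner: the item is split equally among
the bidders whose value is positive and highest. If there are none, then nobody gets it, as
`0 / 0 = 0`. -/
noncomputable def equalSplit (u : ι → ℝ) (i : ι) : ℝ := winWeight u i / ∑ j, winWeight u j

theorem winWeight_nonneg (u : ι → ℝ) (i : ι) : 0 ≤ winWeight u i := by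
  unfold winWeight
  positivity

theorem measurable_equalSplit : Measurable (equalSplit : (ι → ℝ) → ι → ℝ) := by
  have hweight (i : ι) : Measurable fun u : ι → ℝ => winWeight u i := by
    have hwins : MeasurableSet {u : ι → ℝ | 0 < u i ∧ ∀ j, u j ≤ u i} := by
      simp only [Set.ofPred_and, Set.ofPred_forall]
      exact (measurableSet_lt measurable_const (measurable_pi_apply i)).inter
        (.iInter fun j => measurableSet_le (measurable_pi_apply j) (measurable_pi_apply i))
    exact Measurable.ite hwins measurable_const measurable_const
  exact measurable_pi_lambda _ fun i =>
    (hweight i).div (Finset.measurable_fun_sum _ fun j _ => hweight j)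

theorem equalSplit_mem_subsimplex (u : ι → ℝ) : equalSplit u ∈ subsimplex ι := by
  refine ⟨fun i => div_nonneg (winWeight_nonneg u i)
    (Finset.sum_nonneg fun j _ => winWeight_nonneg u j), ?_⟩
  simp only [equalSplit, ← Finset.sum_div]
  exact div_self_le_one _

theorem sum_equalSplit_mul (u : ι → ℝ) : ∑ i, equalSplit u i * u i = ⨆ i, max (u i) 0 := by
  by_cases hpos : ∃ i, 0 < u i
  · obtain ⟨i, hi⟩ := hpos
    have : Nonempty ι := ⟨i⟩
    obtain ⟨k, hk⟩ := Finite.exists_max u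
    have hk0 : 0 < u k := hi.trans_le (hk i)
    have hmul (j : ι) : winWeight u j * u j = winWeight u j * u k := by
      unfold winWeight
      split_ifs with hj
      · rw [(hk j).antisymm (hj.2 k)]
      · simp only [zero_mul]
    have hsum : 0 < ∑ j, winWeight u j :=
      Finset.sum_pos' (fun j _ => winWeight_nonneg u j)
        ⟨k, Finset.mem_univ k, by simp [winWeight, hk0, hk]⟩
    calc ∑ j, equalSplit u j * u j
      _ = (∑ j, winWeight u j) / (∑ j, winWeight u j) * u k := by
          simp only [equalSplit, div_mul_eq_mul_div, hmul, ← Finset.sum_div, ← Finset.sum_mul]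
      _ = u k := by rw [div_self hsum.ne', one_mul]
      _ = ⨆ j, max (u j) 0 := le_antisymm
          ((le_max_left _ _).trans (le_ciSup (f := fun j => max (u j) 0)
            (Set.finite_range _).bddAbove k)) (ciSup_le fun j => max_le (hk j) hk0.le)
  · push Not at hpos
    simp [equalSplit, winWeight, hpos, (hpos _).not_gt]

end EqualSplit

theorem setAverage_le_setAverage_of_ae {X : Type*} [MeasurableSpace X] {μ : Measure X}
    [IsFiniteMeasure μ] {q : X → ℝ} (hq : Integrable q μ) {C D S : Set X} (hC : μ C ≠ 0)
    (hD : μ D ≠ 0) (hS : ∀ᵐ t ∂μ, t ∈ S) (hle : ∀ c ∈ C ∩ S, ∀ d ∈ D ∩ S, q d ≤ q c) :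
    ⨍ t in D, q t ∂μ ≤ ⨍ t in C, q t ∂μ := by
  have hCmean := measure_le_setAverage_pos hC (measure_ne_top μ C) hq.integrableOn
  have hDmean := measure_setAverage_le_pos hD (measure_ne_top μ D) hq.integrableOn
  obtain ⟨c, ⟨hcC, hc⟩, hcS⟩ := ((frequently_ae_iff.2 hCmean.ne').and_eventually hS).exists
  obtain ⟨d, ⟨hdD, hd⟩, hdS⟩ := ((frequently_ae_iff.2 hDmean.ne').and_eventually hS).exists
  exact hd.trans ((hle c ⟨hcC, hcS⟩ d ⟨hdD, hdS⟩).trans hc)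

section ReducedForm

variable {ι : Type*} [Fintype ι] {X : ι → Type*} [∀ i, MeasurableSpace (X i)]

/-- Feasibility of an allocation rule for one item and bidders `i : ι` with independent types of
laws `μ i`: at almost every type profile at most one item is allocated. -/
structure IsFeasible (μ : ∀ i, Measure (X i)) (a : (∀ i, X i) → ι → ℝ) : Prop where
  measurable : Measurable a
  ae_mem_subsimplex : ∀ᵐ s ∂Measure.pi μ, a s ∈ subsimplex ι

/-- The expected allocation of bidder `i` of type `t`: all types are drawn, and that of `i` is
then overwritten by `t`. -/
noncomputable def interimAllocation [DecidableEq ι] (μ : ∀ i, Measure (X i))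
    (a : (∀ i, X i) → ι → ℝ) (i : ι) (t : X i) : ℝ :=
  ∫ s, a (Function.update s i t) i ∂Measure.pi μ

/-- `q` is a reduced form: the family of interim allocations of some feasible allocation rule. -/
def IsReducedForm [DecidableEq ι] (μ : ∀ i, Measure (X i)) (q : ∀ i, X i → ℝ) : Prop :=
  ∃ a, IsFeasible μ a ∧ ∀ i, interimAllocation μ a i =ᵐ[μ i] q i

variable {μ : ∀ i, Measure (X i)} {a : (∀ i, X i) → ι → ℝ}

namespace IsFeasible

theorem ae_norm_le_one (ha : IsFeasible μ a) (i : ι) :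
    ∀ᵐ s ∂Measure.pi μ, ‖a s i‖ ≤ 1 := by
  filter_upwards [ha.ae_mem_subsimplex] with s hs
  obtain ⟨h0, h1⟩ := mem_Icc_of_mem_subsimplex hs i
  rwa [Real.norm_of_nonneg h0]

theorem measurable_apply (ha : IsFeasible μ a) (i : ι) : Measurable fun s => a s i :=
  (measurable_pi_apply i).comp ha.measurable

variable [∀ i, IsProbabilityMeasure (μ i)]

theorem integrable_mul_eval (ha : IsFeasible μ a) {i : ι} {y : X i → ℝ}
    (hy : Integrable y (μ i)) : Integrable (fun s => a s i * y (s i)) (Measure.pi μ) :=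
  (integrable_comp_eval hy).bdd_mul (ha.measurable_apply i).aestronglyMeasurable
    (ha.ae_norm_le_one i)

variable [DecidableEq ι]

theorem integrable_interimAllocation (ha : IsFeasible μ a) (i : ι) :
    Integrable (interimAllocation μ a i) (μ i) := by
  have hai : Integrable (fun s => a s i) (Measure.pi μ) :=
    .of_bound (ha.measurable_apply i).aestronglyMeasurable 1 (ha.ae_norm_le_one i)
  exact (((measurePreserving_update μ i).integrable_comp hai.aestronglyMeasurable).2
    hai).integral_prod_left

theorem integral_mul_eval (ha : IsFeasible μ a) {i : ι} {y : X i → ℝ} (hy : Integrable y (μ i)) :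
    ∫ s, a s i * y (s i) ∂Measure.pi μ = ∫ t, interimAllocation μ a i t * y t ∂μ i :=
  integral_pi_mul_eval i (ha.integrable_mul_eval hy)

theorem integral_sum_mul_eval (ha : IsFeasible μ a) {q x : ∀ i, X i → ℝ}
    (hq : ∀ i, interimAllocation μ a i =ᵐ[μ i] q i) (hx : ∀ i, Integrable (x i) (μ i)) :
    ∫ s, ∑ i, a s i * x i (s i) ∂Measure.pi μ = ∑ i, ∫ t, q i t * x i t ∂μ i := by
  rw [integral_finsetSum _ fun i _ => ha.integrable_mul_eval (hx i)]
  exact Finset.sum_congr rfl fun i _ => (ha.integral_mul_eval (hx i)).trans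
    (integral_congr_ae ((hq i).mul .rfl))

end IsFeasible

theorem integrable_of_ae_mem_Icc {X : Type*} [MeasurableSpace X] {μ : Measure X}
    [IsFiniteMeasure μ] {y : X → ℝ} {M : ℝ} (hy : Measurable y)
    (hyM : ∀ᵐ t ∂μ, y t ∈ Set.Icc 0 M) : Integrable y μ :=
  .of_bound hy.aestronglyMeasurable M <| hyM.mono fun _ ht => by
    simpa only [Real.norm_of_nonneg ht.1] using ht.2

namespace IsReducedForm

variable [∀ i, IsProbabilityMeasure (μ i)] [DecidableEq ι] {q x : ∀ i, X i → ℝ} {M : ℝ}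

theorem integrable (h : IsReducedForm μ q) (i : ι) : Integrable (q i) (μ i) := by
  obtain ⟨a, ha, hq⟩ := h
  exact (ha.integrable_interimAllocation i).congr (hq i)

theorem exists_forall_mem_subsimplex (h : IsReducedForm μ q) :
    ∃ a, Measurable a ∧ (∀ s, a s ∈ subsimplex ι) ∧ ∀ i, interimAllocation μ a i =ᵐ[μ i] q i := by
  obtain ⟨a, ha, hq⟩ := h
  refine ⟨(subsimplex ι).indicator id ∘ a,
    (measurable_id.indicator measurableSet_subsimplex).comp ha.measurable, fun s => ?_,
    fun i => ?_⟩
  · by_cases hs : a s ∈ subsimplex ι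
    · rwa [Function.comp_apply, Set.indicator_of_mem hs]
    · rw [Function.comp_apply, Set.indicator_of_notMem hs]
      exact ⟨fun _ => le_rfl, by simp⟩
  · filter_upwards [hq i, ae_ae_update ha.ae_mem_subsimplex i] with t htq ht
    rw [← htq]
    exact integral_congr_ae (ht.mono fun s hs => congrFun (Set.indicator_of_mem hs id) i)

variable [Nonempty ι]

theorem sum_integral_mul_le (h : IsReducedForm μ q) (hx : ∀ i, Measurable (x i))
    (hxM : ∀ i, ∀ᵐ t ∂μ i, x i t ∈ Set.Icc 0 M) :
    ∑ i, ∫ t, q i t * x i t ∂μ i ≤ ∫ s, ⨆ i, x i (s i) ∂Measure.pi μ := by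
  obtain ⟨a, ha, hq⟩ := h
  have hx_int (i : ι) := integrable_of_ae_mem_Icc (hx i) (hxM i)
  rw [← ha.integral_sum_mul_eval hq hx_int]
  refine integral_mono_ae (integrable_finsetSum _ fun i _ => ha.integrable_mul_eval (hx_int i))
    (integrable_iSup_eval hx hxM) ?_
  filter_upwards [ha.ae_mem_subsimplex, ae_pi_eval_mem_Icc hxM] with s hs hxs
  exact sum_mul_le_iSup hs fun i => (hxs i).1

theorem exists_forall_lt_imp_le (h : IsReducedForm μ q) (hx : ∀ i, Measurable (x i))
    (hxM : ∀ i, ∀ᵐ t ∂μ i, x i t ∈ Set.Icc 0 M)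
    (heq : ∑ i, ∫ t, q i t * x i t ∂μ i = ∫ s, ⨆ i, x i (s i) ∂Measure.pi μ) (i : ι) :
    ∃ S : Set (X i), (∀ᵐ t ∂μ i, t ∈ S) ∧ ∀ c ∈ S, ∀ d ∈ S, x i d < x i c → q i d ≤ q i c := by
  obtain ⟨a, ha, hq⟩ := h
  have hx_int (i : ι) := integrable_of_ae_mem_Icc (hx i) (hxM i)
  have hnonneg : ∀ᵐ s ∂Measure.pi μ, ∀ j, 0 ≤ x j (s j) :=
    (ae_pi_eval_mem_Icc hxM).mono fun s hs j => (hs j).1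
  have hopt : ∀ᵐ s ∂Measure.pi μ, ∑ j, a s j * x j (s j) = ⨆ j, x j (s j) := by
    refine (integral_eq_iff_of_ae_le
      (integrable_finsetSum _ fun i _ => ha.integrable_mul_eval (hx_int i))
      (integrable_iSup_eval hx hxM) ?_).1 ((ha.integral_sum_mul_eval hq hx_int).trans heq)
    filter_upwards [ha.ae_mem_subsimplex, hnonneg] with s hs hxs using sum_mul_le_iSup hs hxs
  have hae := ae_ae_update (ha.ae_mem_subsimplex.and (hnonneg.and hopt)) i
  refine ⟨_, (hq i).and hae, fun c ⟨hqc, hc⟩ d ⟨hqd, hd⟩ hdc => ?_⟩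
  rw [← hqc, ← hqd]
  have hc_int : Integrable (fun s => a (Function.update s i c) i) (Measure.pi μ) :=
    integrable_of_ae_mem_Icc ((ha.measurable_apply i).comp measurable_update_left)
      (hc.mono fun s hs => mem_Icc_of_mem_subsimplex hs.1 i)
  refine integral_mono_of_nonneg (hd.mono fun s hs => hs.1.1 i) hc_int ?_
  filter_upwards [hc, hd] with s hcs hds
  exact apply_le_apply_of_sum_mul_eq_iSup hds.1 hcs.1 hds.2.1 hds.2.2 hcs.2.2
    (fun j hj => by simp only [Function.update_of_ne hj])
    (by simpa only [Function.update_self] using hdc)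

end IsReducedForm

end ReducedForm

section SupportFunction

variable {Ω V : Type*} [MeasurableSpace Ω] {ν : Measure Ω} [AddCommGroup V] [Module ℝ V]

theorem exists_forall_integral_inner_eq_of_forall_exists_le [IsFiniteMeasure ν] {F : Type*}
    [NormedAddCommGroup F] [InnerProductSpace ℝ F] [CompleteSpace F] {K : Set F}
    (hconv : Convex ℝ K) (hclosed : IsClosed K) (hbdd : Bornology.IsBounded K)
    (J : V →ₗ[ℝ] Ω → F) (hJ : ∀ v, MemLp (J v) 2 ν) (ℓ : V →ₗ[ℝ] ℝ)
    (h : ∀ v, ∃ p : Ω → F, StronglyMeasurable p ∧ (∀ s, p s ∈ K) ∧ ℓ v ≤ ∫ s, ⟪J v s, p s⟫ ∂ν) :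
    ∃ a : Ω → F, StronglyMeasurable a ∧ (∀ᵐ s ∂ν, a s ∈ K) ∧
      ∀ v, ∫ s, ⟪J v s, a s⟫ ∂ν = ℓ v := by
  let J₂ : V →ₗ[ℝ] Lp F 2 ν :=
    { toFun := fun v => (hJ v).toLp _
      map_add' := fun v w => by
        simp only [map_add]
        exact MemLp.toLp_add (hJ v) (hJ w)
      map_smul' := fun c v => by
        simp only [map_smul]
        exact MemLp.toLp_const_smul c (hJ v) }
  have hinner (v : V) (g : Lp F 2 ν) : ⟪J₂ v, g⟫ = ∫ s, ⟪J v s, g s⟫ ∂ν :=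
    (L2.inner_def _ _).trans <| integral_congr_ae <|
      (hJ v).coeFn_toLp.mono fun s hs => congrArg (⟪·, g s⟫) hs
  have hsupport (v : V) : ∃ g ∈ {g : Lp F 2 ν | ∀ᵐ s ∂ν, g s ∈ K}, ℓ v ≤ ⟪J₂ v, g⟫ := by
    obtain ⟨p, hp, hpK, hle⟩ := h v
    obtain ⟨C, hC⟩ := hbdd.exists_norm_le
    have hp₂ : MemLp p 2 ν := .of_bound hp.aestronglyMeasurable C (.of_forall fun s => hC _ (hpK s))
    refine ⟨hp₂.toLp p, ?_, hle.trans_eq ?_⟩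
    · filter_upwards [hp₂.coeFn_toLp] with s hs
      exact hs ▸ hpK s
    · rw [hinner]
      exact integral_congr_ae (hp₂.coeFn_toLp.mono fun s hs => congrArg (⟪J v s, ·⟫) hs.symm)
  obtain ⟨g, hgK, hg⟩ := exists_forall_inner_eq_of_forall_exists_le
    (A := {g : Lp F 2 ν | ∀ᵐ s ∂ν, g s ∈ K}) (convex_setOf_ae_mem hconv)
    (isClosed_setOf_ae_mem hclosed) (isBounded_setOf_ae_mem hbdd) J₂ ℓ hsupport
  exact ⟨g, Lp.stronglyMeasurable g, hgK, fun v => (hinner v g).symm.trans (hg v)⟩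

theorem exists_forall_integral_sum_mul_eq_of_forall_exists_le {ι : Type*} [Fintype ι]
    [IsFiniteMeasure ν] {K : Set (ι → ℝ)} (hconv : Convex ℝ K) (hclosed : IsClosed K)
    (hbdd : Bornology.IsBounded K) (J : V →ₗ[ℝ] Ω → ι → ℝ)
    (hJ : ∀ v i, MemLp (fun s => J v s i) 2 ν) (ℓ : V →ₗ[ℝ] ℝ)
    (h : ∀ v, ∃ p : Ω → ι → ℝ, Measurable p ∧ (∀ s, p s ∈ K) ∧
      ℓ v ≤ ∫ s, ∑ i, p s i * J v s i ∂ν) :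
    ∃ a : Ω → ι → ℝ, Measurable a ∧ (∀ᵐ s ∂ν, a s ∈ K) ∧
      ∀ v, ∫ s, ∑ i, a s i * J v s i ∂ν = ℓ v := by
  let e : (ι → ℝ) ≃ₗ[ℝ] EuclideanSpace ℝ ι := (WithLp.linearEquiv 2 ℝ (ι → ℝ)).symm
  obtain ⟨a, ha, haK, haℓ⟩ := exists_forall_integral_inner_eq_of_forall_exists_le
    (hconv.linear_preimage e.symm.toLinearMap) (hclosed.preimage (PiLp.continuous_ofLp 2 _))
    ((PiLp.antilipschitzWith_ofLp 2 fun _ : ι => ℝ).isBounded_preimage hbdd)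
    (e.toLinearMap.compLeft Ω ∘ₗ J) (fun v => .of_eval_piLp (hJ v)) ℓ fun v => by
      obtain ⟨p, hp, hpK, hle⟩ := h v
      exact ⟨fun s => e (p s), ((WithLp.measurable_toLp 2 _).comp hp).stronglyMeasurable, hpK, hle⟩
  exact ⟨fun s => e.symm (a s), (WithLp.measurable_ofLp 2 _).comp ha.measurable, haK, haℓ⟩

end SupportFunction

section Sufficiency

theorem integrable_mul_simpleFunc {X : Type*} [MeasurableSpace X] {μ : Measure X} {q : X → ℝ}
    (hq : Integrable q μ) (v : SimpleFunc X ℝ) : Integrable (fun t => q t * v t) μ :=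
  (hq.simpleFunc_mul v).congr (.of_forall fun t => mul_comm (v t) (q t))

variable {ι : Type*} [Fintype ι] {X : ι → Type*} [∀ i, MeasurableSpace (X i)]
  {μ : ∀ i, Measure (X i)} {q : ∀ i, X i → ℝ}

theorem isLinearMap_sum_integral_mul_simpleFunc (hq : ∀ i, Integrable (q i) (μ i)) :
    IsLinearMap ℝ fun v : ∀ i, SimpleFunc (X i) ℝ => ∑ i, ∫ t, q i t * v i t ∂μ i where
  map_add v w := by
    simp only [Pi.add_apply, SimpleFunc.coe_add, mul_add, ← Finset.sum_add_distrib]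
    exact Finset.sum_congr rfl fun i _ => integral_add (integrable_mul_simpleFunc (hq i) (v i))
      (integrable_mul_simpleFunc (hq i) (w i))
  map_smul c v := by
    simp only [Pi.smul_apply, SimpleFunc.coe_smul, smul_eq_mul, mul_left_comm _ c,
      integral_const_mul, Finset.mul_sum]

theorem sum_integral_mul_le_integral_sum_equalSplit_mul (hq : ∀ i, Integrable (q i) (μ i))
    (hq0 : ∀ i, 0 ≤ᵐ[μ i] q i)
    (h : ∀ x : ∀ i, SimpleFunc (X i) ℝ, (∀ i t, 0 ≤ x i t) →
      ∑ i, ∫ t, q i t * x i t ∂μ i ≤ ∫ s, ⨆ i, x i (s i) ∂Measure.pi μ)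
    (v : ∀ i, SimpleFunc (X i) ℝ) :
    ∑ i, ∫ t, q i t * v i t ∂μ i ≤
      ∫ s, ∑ i, equalSplit (fun j => v j (s j)) i * v i (s i) ∂Measure.pi μ :=
  calc ∑ i, ∫ t, q i t * v i t ∂μ i
    _ ≤ ∑ i, ∫ t, q i t * (v i ⊔ 0) t ∂μ i := by
        refine Finset.sum_le_sum fun i _ => ?_
        refine integral_mono_ae (integrable_mul_simpleFunc (hq i) _)
          (integrable_mul_simpleFunc (hq i) _) ((hq0 i).mono fun t ht => ?_)
        exact mul_le_mul_of_nonneg_left le_sup_left ht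
    _ ≤ ∫ s, ⨆ i, (v i ⊔ 0) (s i) ∂Measure.pi μ := h _ fun i t => le_sup_right
    _ = ∫ s, ∑ i, equalSplit (fun j => v j (s j)) i * v i (s i) ∂Measure.pi μ :=
        integral_congr_ae (.of_forall fun s => (sum_equalSplit_mul fun i => v i (s i)).symm)

variable [∀ i, IsProbabilityMeasure (μ i)]

theorem exists_isFeasible_forall_integral_sum_mul_eq (hq : ∀ i, Integrable (q i) (μ i))
    (hq0 : ∀ i, 0 ≤ᵐ[μ i] q i)
    (h : ∀ x : ∀ i, SimpleFunc (X i) ℝ, (∀ i t, 0 ≤ x i t) →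
      ∑ i, ∫ t, q i t * x i t ∂μ i ≤ ∫ s, ⨆ i, x i (s i) ∂Measure.pi μ) :
    ∃ a, IsFeasible μ a ∧ ∀ v : ∀ i, SimpleFunc (X i) ℝ,
      ∫ s, ∑ i, a s i * v i (s i) ∂Measure.pi μ = ∑ i, ∫ t, q i t * v i t ∂μ i := by
  let J : (∀ i, SimpleFunc (X i) ℝ) →ₗ[ℝ] (∀ i, X i) → ι → ℝ :=
    { toFun := fun v s i => v i (s i)
      map_add' := fun _ _ => rfl
      map_smul' := fun _ _ => rfl }
  have hJ (v : ∀ i, SimpleFunc (X i) ℝ) (i : ι) : Measurable fun s => J v s i :=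
    (v i).measurable.comp (measurable_pi_apply i)
  obtain ⟨a, ha, haK, hav⟩ := exists_forall_integral_sum_mul_eq_of_forall_exists_le
    (ν := Measure.pi μ) convex_subsimplex isClosed_subsimplex isBounded_subsimplex J
    (fun v i => ((v i).memLp_of_isFiniteMeasure 2 (μ i)).comp_measurePreserving
      (measurePreserving_eval μ i))
    (isLinearMap_sum_integral_mul_simpleFunc hq).mk' fun v =>
      ⟨_, measurable_equalSplit.comp (measurable_pi_lambda _ (hJ v)),
        fun s => equalSplit_mem_subsimplex _,
        sum_integral_mul_le_integral_sum_equalSplit_mul hq hq0 h v⟩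
  exact ⟨a, ⟨ha, haK⟩, hav⟩

theorem isReducedForm_of_forall_simpleFunc [DecidableEq ι] (hq : ∀ i, Integrable (q i) (μ i))
    (hq0 : ∀ i, 0 ≤ᵐ[μ i] q i)
    (h : ∀ x : ∀ i, SimpleFunc (X i) ℝ, (∀ i t, 0 ≤ x i t) →
      ∑ i, ∫ t, q i t * x i t ∂μ i ≤ ∫ s, ⨆ i, x i (s i) ∂Measure.pi μ) :
    IsReducedForm μ q := by
  obtain ⟨a, ha, hav⟩ := exists_isFeasible_forall_integral_sum_mul_eq hq hq0 h
  refine ⟨a, ha, fun i => (ha.integrable_interimAllocation i).ae_eq_of_forall_setIntegral_eq _ _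
    (hq i) fun S hS _ => ?_⟩
  let v : ∀ j, SimpleFunc (X j) ℝ := Pi.single i ((SimpleFunc.const _ 1).restrict S)
  have hv (g : ∀ j, X j → ℝ) : ∑ j, ∫ t, g j t * v j t ∂μ j = ∫ t in S, g i t ∂μ i := by
    rw [Fintype.sum_eq_single i fun j hj => by simp [v, Pi.single_eq_of_ne hj],
      ← integral_indicator hS]
    congr 1 with t
    by_cases ht : t ∈ S <;> simp [v, hS, ht]
  rw [← hv, ← hv, ← hav v, ha.integral_sum_mul_eval (fun _ => .rfl)
    fun j => (v j).integrable_of_isFiniteMeasure]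

end Sufficiency

section Symmetric

variable {X : Type*} [MeasurableSpace X]

/-- The bound of Border's condition at the weight function `x ≤ M`: one `n`-th of the expected
maximum of `x` over `n` independent types of law `μ`, in layer-cake form. -/
noncomputable def maxShare (n : ℕ) (M : ℝ) (μ : Measure X) (x : X → ℝ) : ℝ :=
  ∫ v in (0 : ℝ)..M, (1 - (1 - μ.real {t | v ≤ x t}) ^ n) / n

/-- Border's condition on an interim allocation `q` of `n` bidders with types of law `μ`, tested on
weight functions bounded by `M`. -/
def BorderCondition (n : ℕ) (M : ℝ) (μ : Measure X) (q : X → ℝ) : Prop :=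
  ∀ x : X → ℝ, Measurable x → (∀ᵐ t ∂μ, x t ∈ Set.Icc 0 M) →
    Integrable (fun t => q t * x t) μ ∧ ∫ t, q t * x t ∂μ ≤ maxShare n M μ x

variable {μ : Measure X} {q x : X → ℝ} {M : ℝ}

theorem maxShare_congr_ae {y : X → ℝ} (h : x =ᵐ[μ] y) (n : ℕ) (M : ℝ) :
    maxShare n M μ x = maxShare n M μ y := by
  have htail (v : ℝ) : μ.real {t | v ≤ x t} = μ.real {t | v ≤ y t} :=
    measureReal_congr (h.mono fun t ht => congrArg (v ≤ ·) ht)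
  simp only [maxShare, htail]

theorem BorderCondition.integrable {n : ℕ} (h : BorderCondition n M μ q) (hM : 0 < M) :
    Integrable q μ :=
  (integrable_mul_const_iff (isUnit_iff_ne_zero.2 hM.ne') q).1
    (h (fun _ => M) measurable_const (.of_forall fun _ => ⟨hM.le, le_rfl⟩)).1

variable {ι : Type*} [Fintype ι] [Nonempty ι] [IsProbabilityMeasure μ]

theorem card_mul_maxShare (hx : Measurable x) (hxM : ∀ᵐ t ∂μ, x t ∈ Set.Icc 0 M) :
    Fintype.card ι * maxShare (Fintype.card ι) M μ x =
      ∫ s : ι → X, ⨆ i, x (s i) ∂Measure.pi (fun _ => μ) := by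
  rw [integral_iSup_eval (fun _ : ι => hx) fun _ => hxM, maxShare,
    ← intervalIntegral.integral_const_mul]
  simp only [Finset.prod_const, Finset.card_univ]
  congr 1 with v
  exact mul_div_cancel₀ _ (Nat.cast_ne_zero.2 Fintype.card_ne_zero)

namespace BorderCondition

theorem card_mul_integral_mul_le (h : BorderCondition (Fintype.card ι) M μ q) (hM : 0 < M)
    {c : ℝ} (hx : Measurable x) (hxc : ∀ᵐ t ∂μ, x t ∈ Set.Icc 0 c) :
    Fintype.card ι * ∫ t, q t * x t ∂μ ≤
      ∫ s : ι → X, ⨆ i, x (s i) ∂Measure.pi (fun _ => μ) := by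
  have hc : 0 ≤ c := by
    obtain ⟨t, ht⟩ := hxc.exists
    exact ht.1.trans ht.2
  let r := M / (c + 1)
  have hr : 0 < r := by positivity
  have hrx : ∀ᵐ t ∂μ, r * x t ∈ Set.Icc 0 M := by
    filter_upwards [hxc] with t ht
    refine ⟨mul_nonneg hr.le ht.1, ?_⟩
    calc r * x t
      _ ≤ r * (c + 1) := by gcongr; linarith [ht.2]
      _ = M := div_mul_cancel₀ M (by positivity)
  have hbound := mul_le_mul_of_nonneg_left (h _ (hx.const_mul r) hrx).2
    (Nat.cast_nonneg (Fintype.card ι))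
  rw [card_mul_maxShare (hx.const_mul r) hrx] at hbound
  simp only [mul_left_comm _ r, integral_const_mul, ← Real.mul_iSup_of_nonneg hr.le] at hbound
  exact le_of_mul_le_mul_left hbound hr

theorem sum_integral_mul_le (h : BorderCondition (Fintype.card ι) M μ q) (hM : 0 < M) {c : ℝ}
    {x : ι → X → ℝ} (hx : ∀ i, Measurable (x i)) (hxc : ∀ i, ∀ᵐ t ∂μ, x i t ∈ Set.Icc 0 c) :
    ∑ i, ∫ t, q t * x i t ∂μ ≤ ∫ s : ι → X, ⨆ i, x i (s i) ∂Measure.pi (fun _ => μ) := by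
  refine le_of_mul_le_mul_left ?_ (Nat.cast_pos.2 (Fintype.card_pos (α := ι)))
  rw [Finset.mul_sum]
  exact (Finset.sum_le_sum fun i _ => h.card_mul_integral_mul_le hM (hx i) (hxc i)).trans
    (sum_integral_iSup_eval_le hx hxc)

theorem isReducedForm [DecidableEq ι] (h : BorderCondition (Fintype.card ι) M μ q) (hM : 0 < M)
    (hq0 : 0 ≤ᵐ[μ] q) : IsReducedForm (fun _ : ι => μ) fun _ => q := by
  refine isReducedForm_of_forall_simpleFunc (fun _ => h.integrable hM) (fun _ => hq0)
    fun x hx0 => ?_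
  choose c hc using fun i => (x i).exists_forall_norm_le
  exact h.sum_integral_mul_le hM (c := ⨆ i, c i) (fun i => (x i).measurable)
    fun i => .of_forall fun t => ⟨hx0 i t, (Real.le_norm_self _).trans <| (hc i t).trans <|
      le_ciSup (Set.finite_range c).bddAbove i⟩

end BorderCondition

theorem IsReducedForm.borderCondition [DecidableEq ι]
    (h : IsReducedForm (fun _ : ι => μ) fun _ => q) :
    BorderCondition (Fintype.card ι) M μ q := by
  intro x hx hxM
  have hx_bdd : ∀ᵐ t ∂μ, ‖x t‖ ≤ M :=
    hxM.mono fun t ht => (Real.norm_of_nonneg ht.1).trans_le ht.2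
  refine ⟨(h.integrable (Classical.arbitrary ι)).mul_bdd hx.aestronglyMeasurable hx_bdd,
    le_of_mul_le_mul_left ?_ (Nat.cast_pos.2 (Fintype.card_pos (α := ι)))⟩
  simpa only [card_mul_maxShare hx hxM, Finset.sum_const, Finset.card_univ, nsmul_eq_mul] using
    h.sum_integral_mul_le (fun _ => hx) fun _ => hxM

theorem IsReducedForm.setAverage_le_setAverage [DecidableEq ι]
    (h : IsReducedForm (fun _ : ι => μ) fun _ => q) (hx : Measurable x)
    (hxM : ∀ᵐ t ∂μ, x t ∈ Set.Icc 0 M)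
    (heq : ∫ t, q t * x t ∂μ = maxShare (Fintype.card ι) M μ x) {C D : Set X} (hC : μ C ≠ 0)
    (hD : μ D ≠ 0) (hlt : ∀ c ∈ C, ∀ d ∈ D, x d < x c) :
    ⨍ t in D, q t ∂μ ≤ ⨍ t in C, q t ∂μ := by
  let i : ι := Classical.arbitrary ι
  obtain ⟨S, hS, hmono⟩ := h.exists_forall_lt_imp_le (fun _ => hx) (fun _ => hxM) (by
    rw [← card_mul_maxShare hx hxM, ← heq, Finset.sum_const, Finset.card_univ, nsmul_eq_mul]) i
  exact setAverage_le_setAverage_of_ae (h.integrable i) hC hD hS fun c hc d hd =>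
    hmono c hc.2 d hd.2 (hlt c hc.1 d hd.1)

end Symmetric

theorem mainTheorem1_general {ι X : Type*} [Fintype ι] [DecidableEq ι] [Nonempty ι]
    [MeasurableSpace X] (μ : Measure X) [IsProbabilityMeasure μ] {q : X → ℝ} (hq0 : 0 ≤ᵐ[μ] q)
    {M : ℝ} (hM : 0 < M) :
    (IsReducedForm (fun _ : ι => μ) (fun _ => q) ↔ BorderCondition (Fintype.card ι) M μ q) ∧
    (IsReducedForm (fun _ : ι => μ) (fun _ => q) →
      ∀ x : X → ℝ, Measurable x → (∀ᵐ t ∂μ, x t ∈ Set.Icc 0 M) →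
        ∫ t, q t * x t ∂μ = maxShare (Fintype.card ι) M μ x →
        ∀ C D : Set X, μ C ≠ 0 → μ D ≠ 0 → (∀ c ∈ C, ∀ d ∈ D, x d < x c) →
          ⨍ t in D, q t ∂μ ≤ ⨍ t in C, q t ∂μ) :=
  ⟨⟨fun h => h.borderCondition, fun h => h.isReducedForm hM hq0⟩,
    fun h _ hx hxM heq _ _ hC hD hlt => h.setAverage_le_setAverage hx hxM heq hC hD hlt⟩

section TypeLaw

variable {b : ℝ} {f : ℝ → ℝ}

theorem typeLaw_ae_mem_Icc : ∀ᵐ t ∂typeLaw b f, t ∈ Set.Icc 0 b :=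
  (withDensity_absolutelyContinuous _ _).ae_le (ae_restrict_mem measurableSet_Icc)

theorem IsVirtualValue.ae_typeLaw_mem_Icc {vbar : ℝ} {x : ℝ → ℝ} (hx : IsVirtualValue b vbar x) :
    ∀ᵐ t ∂typeLaw b f, x t ∈ Set.Icc 0 vbar :=
  typeLaw_ae_mem_Icc.mono hx.2

theorem isProbabilityMeasure_typeLaw (hf_nonneg : ∀ t ∈ Set.Icc 0 b, 0 ≤ f t)
    (hf_one : ∫ t in Set.Icc 0 b, f t = 1) : IsProbabilityMeasure (typeLaw b f) := by
  have hint : IntegrableOn f (Set.Icc 0 b) := by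
    by_contra h
    rw [integral_undef h] at hf_one
    exact zero_ne_one hf_one
  refine ⟨?_⟩
  rw [typeLaw, withDensity_apply _ MeasurableSet.univ, Measure.restrict_univ,
    ← ofReal_integral_eq_lintegral_ofReal hint
    ((ae_restrict_iff' measurableSet_Icc).2 (.of_forall hf_nonneg)), hf_one, ENNReal.ofReal_one]

section Density

variable (hf_meas : Measurable f) (hf_nonneg : ∀ t ∈ Set.Icc 0 b, 0 ≤ f t)
include hf_meas hf_nonneg

theorem setIntegral_mul_density (g : ℝ → ℝ) {C : Set ℝ} (hC : MeasurableSet C)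
    (hCb : C ⊆ Set.Icc 0 b) : ∫ t in C, g t * f t = ∫ t in C, g t ∂typeLaw b f := by
  rw [typeLaw, setIntegral_withDensity_eq_setIntegral_toReal_smul hf_meas.ennreal_ofReal
    (.of_forall fun _ => ENNReal.ofReal_lt_top) g hC, Measure.restrict_restrict hC,
    Set.inter_eq_left.2 hCb]
  refine setIntegral_congr_fun hC fun t ht => ?_
  simp only [ENNReal.toReal_ofReal (hf_nonneg t (hCb ht)), smul_eq_mul]
  exact mul_comm _ _

theorem setIntegral_density {C : Set ℝ} (hC : MeasurableSet C) (hCb : C ⊆ Set.Icc 0 b) :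
    ∫ t in C, f t = (typeLaw b f).real C := by
  simpa using setIntegral_mul_density hf_meas hf_nonneg (fun _ => 1) hC hCb

theorem typeLaw_ne_zero_of_setIntegral_pos {C : Set ℝ} (hC : MeasurableSet C)
    (hCb : C ⊆ Set.Icc 0 b) (hpos : 0 < ∫ t in C, f t) : typeLaw b f C ≠ 0 := fun h => by
  rw [setIntegral_density hf_meas hf_nonneg hC hCb, measureReal_def, h] at hpos
  exact lt_irrefl _ hpos

theorem setAverage_typeLaw (q : ℝ → ℝ) {C : Set ℝ} (hC : MeasurableSet C)
    (hCb : C ⊆ Set.Icc 0 b) :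
    ⨍ t in C, q t ∂typeLaw b f = (∫ t in C, q t * f t) / ∫ t in C, f t := by
  rw [setIntegral_mul_density hf_meas hf_nonneg q hC hCb,
    setIntegral_density hf_meas hf_nonneg hC hCb, setAverage_eq, smul_eq_mul, inv_mul_eq_div]

theorem setIntegral_Icc_mul_density (q x : ℝ → ℝ) :
    ∫ t in Set.Icc 0 b, q t * f t * x t = ∫ t, q t * x t ∂typeLaw b f := by
  simp only [mul_right_comm _ (f _)]
  rw [setIntegral_mul_density hf_meas hf_nonneg _ measurableSet_Icc le_rfl,
    Measure.restrict_eq_self_of_ae_mem typeLaw_ae_mem_Icc]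

theorem integrableOn_Icc_mul_density_iff (q x : ℝ → ℝ) :
    IntegrableOn (fun t => q t * f t * x t) (Set.Icc 0 b) ↔
      Integrable (fun t => q t * x t) (typeLaw b f) := by
  rw [typeLaw, integrable_withDensity_iff_integrable_smul' hf_meas.ennreal_ofReal
    (.of_forall fun _ => ENNReal.ofReal_lt_top)]
  refine integrableOn_congr_fun (fun t ht => ?_) measurableSet_Icc
  simp only [ENNReal.toReal_ofReal (hf_nonneg t ht), smul_eq_mul]
  ring

theorem borderBound_eq_maxShare (n : ℕ) (vbar : ℝ) {x : ℝ → ℝ} (hx : Measurable x) :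
    borderBound n b vbar f x = maxShare n vbar (typeLaw b f) x := by
  unfold borderBound maxShare
  congr 1 with v
  have hset : {t ∈ Set.Icc 0 b | v ≤ x t} =ᵐ[typeLaw b f] {t | v ≤ x t} := by
    filter_upwards [typeLaw_ae_mem_Icc] with t ht
    exact propext (and_iff_right ht)
  rw [setIntegral_density (C := {t | t ∈ Set.Icc 0 b ∧ v ≤ x t}) hf_meas hf_nonneg
    (measurableSet_Icc.inter (measurableSet_le measurable_const hx)) fun t ht => ht.1,
    measureReal_congr hset]

theorem borderCondition_typeLaw_iff {vbar : ℝ} (hvbar : 0 ≤ vbar) (n : ℕ) (q : ℝ → ℝ) :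
    BorderCondition n vbar (typeLaw b f) q ↔ ∀ x, IsVirtualValue b vbar x →
      IntegrableOn (fun t => q t * f t * x t) (Set.Icc 0 b) ∧
        ∫ t in Set.Icc 0 b, q t * f t * x t ≤ borderBound n b vbar f x := by
  constructor
  · intro h x hx
    rw [integrableOn_Icc_mul_density_iff hf_meas hf_nonneg,
      setIntegral_Icc_mul_density hf_meas hf_nonneg,
      borderBound_eq_maxShare hf_meas hf_nonneg n vbar hx.1]
    exact h x hx.1 hx.ae_typeLaw_mem_Icc
  · intro h x hx hxM
    let y (t : ℝ) : ℝ := max 0 (min vbar (x t))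
    have hy : Measurable y := measurable_const.max (measurable_const.min hx)
    have hyx : y =ᵐ[typeLaw b f] x := hxM.mono fun t ht => by
      simp only [y, min_eq_right ht.2, max_eq_right ht.1]
    have hqyx : (fun t => q t * y t) =ᵐ[typeLaw b f] fun t => q t * x t := .mul .rfl hyx
    have hborder := h y ⟨hy, fun t _ => ⟨le_max_left _ _, max_le hvbar (min_le_left _ _)⟩⟩
    rwa [integrableOn_Icc_mul_density_iff hf_meas hf_nonneg,
      setIntegral_Icc_mul_density hf_meas hf_nonneg, borderBound_eq_maxShare hf_meas hf_nonneg n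
      vbar hy, integrable_congr hqyx, integral_congr_ae hqyx, maxShare_congr_ae hyx] at hborder

end Density

theorem implementable_iff_isReducedForm [IsProbabilityMeasure (typeLaw b f)] {n : ℕ}
    {q : ℝ → ℝ} :
    Implementable n b f q ↔ IsReducedForm (fun _ : Fin n => typeLaw b f) fun _ => q := by
  constructor
  · rintro ⟨M, hM⟩
    refine ⟨fun s i => M.alloc i s, ⟨measurable_pi_lambda _ M.measurable_alloc, ?_⟩, hM⟩
    filter_upwards [ae_pi_eval_mem_Icc fun _ => typeLaw_ae_mem_Icc] with s hs
    exact ⟨M.alloc_nonneg s hs, M.sum_alloc_le_one s hs⟩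
  · intro h
    obtain ⟨a, ha, ha_mem, hq⟩ := h.exists_forall_mem_subsimplex
    exact ⟨⟨fun i s => a s i, fun i => (measurable_pi_apply i).comp ha,
      fun s _ => (ha_mem s).1, fun s _ => (ha_mem s).2⟩, hq⟩

end TypeLaw

theorem mainTheorem1 (n : ℕ) (hn : 1 ≤ n) (b : ℝ) (hb : 0 < b)
    (f : ℝ → ℝ) (hf_meas : Measurable f) (hf_nonneg : ∀ t ∈ Set.Icc 0 b, 0 ≤ f t)
    (hf_one : ∫ t in Set.Icc 0 b, f t = 1)
    (q : ℝ → ℝ) (hq_meas : Measurable q) (hq_nonneg : ∀ t ∈ Set.Icc 0 b, 0 ≤ q t)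
    (vbar : ℝ) (hvbar : 0 < vbar) :
    (Implementable n b f q ↔
      ∀ x : ℝ → ℝ, IsVirtualValue b vbar x →
        IntegrableOn (fun t => q t * f t * x t) (Set.Icc 0 b) ∧
        ∫ t in Set.Icc 0 b, q t * f t * x t ≤ borderBound n b vbar f x) ∧
    (Implementable n b f q →
      ∀ x : ℝ → ℝ, IsVirtualValue b vbar x →
        ∫ t in Set.Icc 0 b, q t * f t * x t = borderBound n b vbar f x →
        ∀ C D : Set ℝ, MeasurableSet C → MeasurableSet D →
          C ⊆ Set.Icc 0 b → D ⊆ Set.Icc 0 b →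
          0 < ∫ t in C, f t → 0 < ∫ t in D, f t →
          (∀ c ∈ C, ∀ d ∈ D, x d < x c) →
          (∫ t in D, q t * f t) / (∫ t in D, f t) ≤ (∫ t in C, q t * f t) / (∫ t in C, f t)) := by
  have := isProbabilityMeasure_typeLaw hf_nonneg hf_one
  have : Nonempty (Fin n) := Fin.pos_iff_nonempty.1 hn
  obtain ⟨hborder, hmono⟩ := mainTheorem1_general (ι := Fin n) (typeLaw b f)
    (typeLaw_ae_mem_Icc.mono hq_nonneg) hvbar
  simp only [Fintype.card_fin, ← implementable_iff_isReducedForm] at hborder hmono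
  refine ⟨hborder.trans (borderCondition_typeLaw_iff hf_meas hf_nonneg hvbar.le n q),
    fun h x hx heq C D hC hD hCb hDb hCpos hDpos hlt => ?_⟩
  rw [setIntegral_Icc_mul_density hf_meas hf_nonneg,
    borderBound_eq_maxShare hf_meas hf_nonneg n vbar hx.1] at heq
  rw [← setAverage_typeLaw hf_meas hf_nonneg q hC hCb,
    ← setAverage_typeLaw hf_meas hf_nonneg q hD hDb]
  exact hmono h x hx.1 hx.ae_typeLaw_mem_Icc heq C D
    (typeLaw_ne_zero_of_setIntegral_pos hf_meas hf_nonneg hC hCb hCpos)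
    (typeLaw_ne_zero_of_setIntegral_pos hf_meas hf_nonneg hD hDb hDpos) hlt
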